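/- Let $\mathbb K$ be a field of characteristic $0$ and $R=\mathbb K[x,y,z]$, and let $M=\langle x,y,z\rangle$. Let $\mathcal A$ be an arrangement of $n$ distinct lines in $\mathbb P^2_{\mathbb K}$ with defining linear forms $\ell_1,\ldots,\ell_n\in R$ (so the $\ell_i$ are nonzero and pairwise non-proportional), and suppose that $\mathcal A$ has rank $3$, i.e. $\operatorname{ht}\langle \ell_1,\ldots,\ell_n\rangle=3$. Let $$I=\langle \ell_2\ell_3\cdots\ell_n,\ \ell_1\ell_3\cdots\ell_n,\ \ldots,\ \ell_1\ell_2\cdots\ell_{n-1}\rangle$$ be the ideal generated by all $(n-1)$-fold products of $\ell_1,\ldots,\ell_n$. Let $P_1,\ldots,P_s$ be the points of $\mathbb P^2_{\mathbb K}$ lying on at least two lines of $\mathcal A$, let $n_j$ be the number of lines of $\mathcal A$ through $P_j$, and let $I(P_j)\subset R$ be the ideal generated by all homogeneous polynomials vanishing at $P_j$. Then $I$ is the fat points ideal $$I=I(P_1)^{n_1-1}\cap\cdots\cap I(P_s)^{n_s-1},$$ and, with the symbolic powers of this fat points ideal being $$I^{(t)}=I(P_1)^{t(n_1-1)}\cap\cdots\cap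 I(P_s)^{t(n_s-1)}\qquad(t\ge 1),$$ for every integer $r\ge 1$ one has 1. $I^{(2r-1)}\subseteq M^{r-1}\cdot I^r$; 2. $I^{(2r)}\subseteq M^{r}\cdot I^r$. In particular (by 2.), the containment $I^{(rN)}\subseteq M^{r(N-1)}I^r$ of the Harbourne–Huneke conjecture holds with $N=2$ for the ideal $I$ of every rank-$3$ line arrangement. -/

import Mathlib

open MvPolynomial
open scoped LinearAlgebra.Projectivization

namespace LineArrangement

/-- The homogeneous coordinate ring `K[x, y, z]` of the projective plane over `K`. -/
abbrev CoordRing (K : Type*) [Field K] : Type _ := MvPolynomial (Fin 3) K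

/-- The projective plane over `K`. -/
abbrev Plane (K : Type*) [Field K] : Type _ := ℙ K (Fin 3 → K)

variable {K : Type*} [Field K]

/-- The irrelevant maximal ideal `⟨x, y, z⟩` of `K[x, y, z]`. -/
noncomputable def irrelevantIdeal (K : Type*) [Field K] : Ideal (CoordRing K) :=
  Ideal.span (Set.range (X : Fin 3 → CoordRing K))

/-- The ideal `I(P)` of a point `P`: the ideal generated by all homogeneous polynomials that
vanish at `P`. (For a homogeneous polynomial, vanishing does not depend on the chosen
representative of `P`.) -/
noncomputable def pointIdeal (P : Plane K) : Ideal (CoordRing K) :=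
  Ideal.span {f | (∃ d : ℕ, f.IsHomogeneous d) ∧ eval P.rep f = 0}

/-- The ideal `⋂ I(P) ^ m P`, over the points `P` of `S`, of the fat points scheme `∑ m P • P`
supported on a (finite) set of points `S`. -/
noncomputable def fatPointsIdeal (S : Set (Plane K)) (m : Plane K → ℕ) : Ideal (CoordRing K) :=
  ⨅ P ∈ S, pointIdeal P ^ m P

/-- The `t`-th symbolic power `⋂ I(P) ^ (t * m P)` of the fat points ideal `⋂ I(P) ^ m P`:
all multiplicities are multiplied by `t`. -/
noncomputable def fatPointsSymbolicPower (S : Set (Plane K)) (m : Plane K → ℕ) (t : ℕ) :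
    Ideal (CoordRing K) :=
  fatPointsIdeal S fun P => t * m P

variable {n : ℕ}

/-- The ideal generated by all `(n - 1)`-fold products of the forms `ℓ 1, …, ℓ n`. -/
noncomputable def productIdeal (ℓ : Fin n → CoordRing K) : Ideal (CoordRing K) :=
  Ideal.span (Set.range fun i => ∏ j ∈ Finset.univ.erase i, ℓ j)

/-- The number of lines `ℓ i = 0` passing through the point `P`. -/
noncomputable def numLines (ℓ : Fin n → CoordRing K) (P : Plane K) : ℕ :=
  Set.ncard {i : Fin n | eval P.rep (ℓ i) = 0}

/-- The singular locus: the points that lie on at least two of the lines. -/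
def singularLocus (ℓ : Fin n → CoordRing K) : Set (Plane K) :=
  {P | 2 ≤ numLines ℓ P}

/-- The multiplicity of the line arrangement's fat points scheme at `P`: one less than the number
of lines through `P`. -/
noncomputable def lineMult (ℓ : Fin n → CoordRing K) (P : Plane K) : ℕ :=
  numLines ℓ P - 1

/-- The `t`-th symbolic power of the fat points ideal of the line arrangement. -/
noncomputable def symbolicPower (ℓ : Fin n → CoordRing K) (t : ℕ) : Ideal (CoordRing K) :=
  fatPointsSymbolicPower (singularLocus ℓ) (lineMult ℓ) t

end LineArrangement

/-! Let M be the irrelevant ideal. For a space L of linear forms let w(L) count the lines whose form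
lies in L, and measure vanishing along L by powers of the ideal generated by L. Two facts combine.

From local to global (`mem_mul_foldIdeal`): if f has order at least r * w(L) - r along every L and
lies in M^(nr - r + s), then f lies in M^s times the ideal of (nr - r)-fold products of the forms,
each usable r times. Modulo one more form of the arrangement this is known by induction; the
remaining multiple of that form is divided by it. Such products are products of r generators of I
(`foldIdeal_const_le`).

Initial degree (`eq_zero_of_vanishing`): for δ ≤ 1, a nonzero f in I^(2r-δ) (symbolic power) has
degree at least nr - δ. On a fixed line the numbers w(P) - 1 add up to n - 1, so by Bezout a form of
smaller degree is divisible by every line. Dividing by the product of all lines lowers the degree by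
n and the order at P by w(P) ≤ 2(w(P) - 1), that is, r drops by one.

Since nr - δ = (nr - r) + (r - δ), one may take s = r - δ. The cases δ = 1 and δ = 0 are the two
containments, and r = δ = 1 is the hard half of the equality. -/

namespace LineArrangement

/-! ### Membership and division in ideals generated by monomials. -/

section Monomial

variable {ι K : Type*} [Field K]

theorem le_sum_of_mem_span_X_pow {A : Finset ι} {k : ℕ} {f : MvPolynomial ι K}
    (hf : f ∈ Ideal.span ((X : ι → MvPolynomial ι K) '' (A : Set ι)) ^ k) {m : ι →₀ ℕ}
    (hm : m ∈ f.support) : k ≤ ∑ i ∈ A, m i := by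
  classical
  have key : Ideal.span ((X : ι → MvPolynomial ι K) '' (A : Set ι)) ^ k ≤
      Ideal.span ((fun s => monomial s (1 : K)) '' {s : ι →₀ ℕ | k ≤ ∑ i ∈ A, s i}) := by
    induction k with
    | zero =>
      rw [pow_zero, Ideal.one_eq_top, top_le_iff, Ideal.eq_top_iff_one]
      exact Ideal.subset_span ⟨0, by simp, by simp⟩
    | succ k ih =>
      rw [pow_succ]
      refine (Ideal.mul_mono_left (ih (Ideal.pow_le_pow_right k.le_succ hf))).trans ?_
      rw [Ideal.span_mul_span', Ideal.span_le]
      rintro _ ⟨_, ⟨s, hs, rfl⟩, _, ⟨i, hi, rfl⟩, rfl⟩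
      refine Ideal.subset_span ⟨s + Finsupp.single i 1, ?_, ?_⟩
      · have : ∑ j ∈ A, (Finsupp.single i 1 : ι →₀ ℕ) j = 1 := by
          rw [Finset.sum_eq_single_of_mem i hi]
          · simp
          · intro j _ hj
            simp [hj.symm]
        simpa [Finset.sum_add_distrib, this] using hs
      · simp [X, monomial_mul]
  obtain ⟨s, hs, hle⟩ := mem_ideal_span_monomial_image.1 (key hf) m hm
  exact le_trans hs (Finset.sum_le_sum fun i _ => hle i)

theorem monomial_mem_span_X_pow (A : Finset ι) {k : ℕ} (m : ι →₀ ℕ) (c : K)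
    (h : k ≤ ∑ i ∈ A, m i) :
    monomial m c ∈ Ideal.span ((X : ι → MvPolynomial ι K) '' (A : Set ι)) ^ k := by
  classical
  refine Ideal.pow_le_pow_right h ?_
  rw [← Finset.prod_pow_eq_pow_sum]
  have h1 : ∏ i ∈ A, (X i : MvPolynomial ι K) ^ m i ∈
      ∏ i ∈ A, Ideal.span ((X : ι → MvPolynomial ι K) '' (A : Set ι)) ^ m i :=
    Ideal.prod_mem_prod fun i hi =>
      Ideal.pow_mem_pow (Ideal.subset_span (Set.mem_image_of_mem _ hi)) _
  refine Ideal.mem_of_dvd _ ?_ h1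
  have h2 : ∏ i ∈ A, (X i : MvPolynomial ι K) ^ m i =
      monomial (∑ i ∈ A, Finsupp.single i (m i)) 1 := by
    rw [monomial_sum_one]
    exact Finset.prod_congr rfl fun i _ => X_pow_eq_monomial
  rw [h2, monomial_dvd_monomial]
  refine ⟨Or.inr fun j => ?_, one_dvd _⟩
  rw [Finsupp.finsetSum_apply]
  by_cases hj : j ∈ A
  · rw [Finset.sum_eq_single_of_mem j hj]
    · simp
    · intro i _ hi
      simp [hi]
  · rw [Finset.sum_eq_zero]
    · exact Nat.zero_le _
    · intro i hi
      have : i ≠ j := fun h => hj (h ▸ hi)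
      simp [this]

/-- Membership in the monomial ideal `⟨X i : i ∈ A⟩ ^ k + ⟨X i : i ∈ A₀⟩`. -/
theorem mem_span_X_pow_sup_iff {A A₀ : Finset ι} {k : ℕ} {f : MvPolynomial ι K} :
    f ∈ Ideal.span ((X : ι → MvPolynomial ι K) '' (A : Set ι)) ^ k ⊔
        Ideal.span ((X : ι → MvPolynomial ι K) '' (A₀ : Set ι)) ↔
      ∀ m ∈ f.support, k ≤ ∑ i ∈ A, m i ∨ ∃ i ∈ A₀, m i ≠ 0 := by
  classical
  constructor
  · intro hf m hm
    obtain ⟨x, hx, y, hy, rfl⟩ := Submodule.mem_sup.1 hf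
    rcases Finset.mem_union.1 (support_add hm) with h | h
    · exact Or.inl (le_sum_of_mem_span_X_pow hx h)
    · exact Or.inr (by simpa using mem_ideal_span_X_image.1 hy m h)
  · intro h
    rw [f.as_sum]
    refine Ideal.sum_mem _ fun m hm => ?_
    rcases h m hm with h1 | ⟨i, hi, hmi⟩
    · exact Ideal.mem_sup_left (monomial_mem_span_X_pow A m _ h1)
    · refine Ideal.mem_sup_right (Ideal.mem_of_dvd _ ?_
        (Ideal.subset_span (Set.mem_image_of_mem X hi)))
      exact X_dvd_monomial.2 (Or.inr hmi)

/-- Membership is decided term by term, and multiplication by `X j` adds one to the `j`-th exponent.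
This changes the degree in `A` only if `j ∈ A`, and never creates a variable from `A₀`. -/
theorem mem_of_X_mul_mem {A A₀ : Finset ι} {k k' : ℕ} {f : MvPolynomial ι K} {j : ι}
    (hj : j ∉ A₀) (hk : k' ≤ k) (hk' : j ∈ A → k' ≤ k - 1)
    (hf : X j * f ∈ Ideal.span ((X : ι → MvPolynomial ι K) '' (A : Set ι)) ^ k ⊔
        Ideal.span ((X : ι → MvPolynomial ι K) '' (A₀ : Set ι))) :
    f ∈ Ideal.span ((X : ι → MvPolynomial ι K) '' (A : Set ι)) ^ k' ⊔
        Ideal.span ((X : ι → MvPolynomial ι K) '' (A₀ : Set ι)) := by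
  classical
  rw [mem_span_X_pow_sup_iff] at hf ⊢
  intro m hm
  have hm' : Finsupp.single j 1 + m ∈ (X j * f).support := by
    rw [support_X_mul]
    exact Finset.mem_map.2 ⟨m, hm, rfl⟩
  rcases hf _ hm' with h | ⟨i, hi, hmi⟩
  · left
    simp only [Finsupp.add_apply, Finset.sum_add_distrib] at h
    by_cases hjA : j ∈ A
    · have : ∑ i ∈ A, (Finsupp.single j 1 : ι →₀ ℕ) i ≤ 1 := by
        rw [Finset.sum_eq_single_of_mem j hjA]
        · simp
        · intro i _ hi
          simp [hi]
      have := hk' hjA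
      omega
    · have : ∑ i ∈ A, (Finsupp.single j 1 : ι →₀ ℕ) i = 0 :=
        Finset.sum_eq_zero fun i hi => by
          have : j ≠ i := fun h => hjA (h ▸ hi)
          simp [this]
      omega
  · refine Or.inr ⟨i, hi, ?_⟩
    have : j ≠ i := fun h => hj (h ▸ hi)
    simpa [this] using hmi

end Monomial

/-! ### Ideals of linear flats and division by a linear form. -/

section Flats

variable {K : Type*} [Field K] {σ : Type*} [Fintype σ]

/-- The linear form with coefficient vector `v`. -/
noncomputable def linForm : (σ → K) →ₗ[K] MvPolynomial σ K :=
  Fintype.linearCombination K (X : σ → MvPolynomial σ K)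

/-- The ideal generated by a linear space of linear forms. -/
noncomputable def flatIdeal (L : Submodule K (σ → K)) : Ideal (MvPolynomial σ K) :=
  Ideal.span (linForm '' (L : Set (σ → K)))

theorem linForm_mem_flatIdeal {L : Submodule K (σ → K)} {v : σ → K} (hv : v ∈ L) :
    linForm v ∈ flatIdeal L :=
  Ideal.subset_span (Set.mem_image_of_mem _ hv)

theorem flatIdeal_mono {L L' : Submodule K (σ → K)} (h : L ≤ L') : flatIdeal L ≤ flatIdeal L' :=
  Ideal.span_mono (Set.image_mono h)

theorem flatIdeal_span (s : Set (σ → K)) :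
    flatIdeal (Submodule.span K s) = Ideal.span (linForm '' s) := by
  apply le_antisymm
  · refine Ideal.span_le.2 ?_
    rintro _ ⟨v, hv, rfl⟩
    have hle : Submodule.span K s ≤
        ((Ideal.span (linForm '' s)).restrictScalars K).comap (linForm (K := K) (σ := σ)) :=
      Submodule.span_le.2 fun v hv => Ideal.subset_span (Set.mem_image_of_mem _ hv)
    exact hle hv
  · exact Ideal.span_mono (Set.image_mono Submodule.subset_span)

theorem flatIdeal_sup (L L' : Submodule K (σ → K)) :
    flatIdeal (L ⊔ L') = flatIdeal L ⊔ flatIdeal L' := by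
  have h : L ⊔ L' = Submodule.span K ((L : Set (σ → K)) ∪ L') := by
    rw [Submodule.span_union, Submodule.span_eq, Submodule.span_eq]
  rw [h, flatIdeal_span, Set.image_union, Ideal.span_union]
  rfl

theorem flatIdeal_bot : flatIdeal (⊥ : Submodule K (σ → K)) = ⊥ := by
  simp [flatIdeal]

theorem flatIdeal_span_singleton (w : σ → K) :
    flatIdeal (Submodule.span K {w}) = Ideal.span {linForm w} := by
  rw [flatIdeal_span, Set.image_singleton]

theorem flatIdeal_top : flatIdeal (⊤ : Submodule K (σ → K)) = idealOfVars σ K := by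
  classical
  have h : (⊤ : Submodule K (σ → K)) = Submodule.span K (Set.range (Pi.basisFun K σ)) :=
    (Module.Basis.span_eq _).symm
  rw [h, flatIdeal_span, ← Set.range_comp, idealOfVars]
  congr 2
  ext1 i
  simp [linForm, Fintype.linearCombination_apply_single]

/-- The linear change of coordinates sending the variables to the linear forms of a basis. -/
noncomputable def coordEquiv {ι : Type*} (b : Module.Basis ι K (σ → K)) :
    MvPolynomial ι K ≃ₐ[K] MvPolynomial σ K :=
  (SymmetricAlgebra.equivMvPolynomial b).symm.trans
    (SymmetricAlgebra.equivMvPolynomial (Pi.basisFun K σ))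

theorem coordEquiv_X {ι : Type*} (b : Module.Basis ι K (σ → K)) (i : ι) :
    coordEquiv b (X i) = linForm (b i) := by
  classical
  have h : ((SymmetricAlgebra.equivMvPolynomial (Pi.basisFun K σ)).toLinearMap ∘ₗ
      SymmetricAlgebra.ι K (σ → K)) = linForm := by
    refine (Pi.basisFun K σ).ext fun i => ?_
    simp only [LinearMap.comp_apply, AlgEquiv.toLinearMap_apply,
      SymmetricAlgebra.equivMvPolynomial_ι_apply]
    simp [linForm, Fintype.linearCombination_apply_single]
  simpa [coordEquiv] using LinearMap.congr_fun h (b i)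

theorem map_coordEquiv_span_X {ι : Type*} (b : Module.Basis ι K (σ → K)) (A : Set ι) :
    (Ideal.span ((X : ι → MvPolynomial ι K) '' A)).map (coordEquiv b) =
      flatIdeal (Submodule.span K (b '' A)) := by
  rw [Ideal.map_span, flatIdeal_span, Set.image_image, Set.image_image]
  simp [coordEquiv_X]

-- Parts of a single basis span `L₀` and `L`, with `w` as a further basis vector, so a linear change
-- of coordinates reduces division by a linear form to the monomial case. The vector `w` is adjoined
-- before or after completing a basis of `L`, according to whether `w ∈ L`.
omit [Fintype σ] in
theorem exists_adapted_basis {L₀ L : Submodule K (σ → K)} (hle : L₀ ≤ L) {w : σ → K}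
    (hw : w ∉ L₀) :
    ∃ s₀ s₁ s : Set (σ → K), LinearIndepOn K id s ∧ Submodule.span K s = ⊤ ∧ w ∈ s ∧ s₀ ⊆ s ∧
      s₁ ⊆ s ∧ Submodule.span K s₀ = L₀ ∧ Submodule.span K s₁ = L := by
  classical
  obtain ⟨s₀, hs₀, -, h₀, hi₀⟩ :=
    exists_linearIndepOn_id_extension (K := K) (linearIndepOn_empty K id)
      (Set.empty_subset (L₀ : Set (σ → K)))
  have e₀ : Submodule.span K s₀ = L₀ := le_antisymm (Submodule.span_le.2 hs₀) h₀
  have hiw : LinearIndepOn K id (insert w s₀) :=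
    hi₀.id_insert (by rwa [e₀])
  by_cases hwL : w ∈ L
  · obtain ⟨s₁, hs₁, hsub, h₁, hi₁⟩ :=
      exists_linearIndepOn_id_extension hiw (t := (L : Set (σ → K)))
        (Set.insert_subset hwL (hs₀.trans hle))
    obtain ⟨s, -, hsub', h, hi⟩ := exists_linearIndepOn_id_extension hi₁ (Set.subset_univ s₁)
    refine ⟨s₀, s₁, s, hi, ?_, hsub' (hsub (Set.mem_insert _ _)),
      fun x hx => hsub' (hsub (Set.mem_insert_of_mem _ hx)), hsub', e₀,
      le_antisymm (Submodule.span_le.2 hs₁) h₁⟩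
    exact top_le_iff.1 fun x _ => h (Set.mem_univ x)
  · obtain ⟨s₁, hs₁, hsub, h₁, hi₁⟩ :=
      exists_linearIndepOn_id_extension hi₀ (t := (L : Set (σ → K))) (hs₀.trans hle)
    have e₁ : Submodule.span K s₁ = L := le_antisymm (Submodule.span_le.2 hs₁) h₁
    obtain ⟨s, -, hsub', h, hi⟩ :=
      exists_linearIndepOn_id_extension (hi₁.id_insert (by rwa [e₁])) (Set.subset_univ _)
    refine ⟨s₀, s₁, s, hi, ?_, hsub' (Set.mem_insert _ _),
      fun x hx => hsub' (Set.mem_insert_of_mem _ (hsub hx)),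
      fun x hx => hsub' (Set.mem_insert_of_mem _ hx), e₀, e₁⟩
    exact top_le_iff.1 fun x _ => h (Set.mem_univ x)

/-- Dividing by a linear form outside `L₀` lowers the order of vanishing along `L`, modulo
`L₀`, by one if the form belongs to `L` and by zero otherwise. -/
theorem mem_of_linForm_mul_mem {L₀ L : Submodule K (σ → K)} (hle : L₀ ≤ L) {w : σ → K}
    (hw : w ∉ L₀) {k k' : ℕ} (hk : k' ≤ k) (hk' : w ∈ L → k' ≤ k - 1) {f : MvPolynomial σ K}
    (hf : linForm w * f ∈ flatIdeal L ^ k ⊔ flatIdeal L₀) :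
    f ∈ flatIdeal L ^ k' ⊔ flatIdeal L₀ := by
  classical
  obtain ⟨s₀, s₁, s, hi, hs, hws, hs₀, hs₁, e₀, e₁⟩ := exists_adapted_basis hle hw
  let b : Module.Basis s K (σ → K) :=
    Module.Basis.mk (v := fun x : s => x.1) hi (by simp [hs])
  have hb : ∀ x, b x = x.1 := fun x => Module.Basis.mk_apply _ _ x
  have : Fintype s := FiniteDimensional.fintypeBasisIndex b
  have himg : ∀ t : Set (σ → K), t ⊆ s →
      b '' ((Finset.univ.filter fun x : s => x.1 ∈ t : Finset s) : Set s) = t := by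
    intro t ht
    ext x
    simp only [Finset.coe_filter, Finset.mem_univ, true_and, Set.mem_image, Set.mem_ofPred_eq, hb]
    exact ⟨fun ⟨y, hy, hyx⟩ => hyx ▸ hy, fun hx => ⟨⟨x, ht hx⟩, hx, rfl⟩⟩
  have hmap : ∀ j : ℕ, (Ideal.span ((X : s → MvPolynomial s K) ''
        ((Finset.univ.filter fun x : s => x.1 ∈ s₁ : Finset s) : Set s)) ^ j ⊔
      Ideal.span ((X : s → MvPolynomial s K) ''
        ((Finset.univ.filter fun x : s => x.1 ∈ s₀ : Finset s) : Set s))).map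
        (coordEquiv b) = flatIdeal L ^ j ⊔ flatIdeal L₀ := by
    intro j
    rw [Ideal.map_sup, Ideal.map_pow, map_coordEquiv_span_X, map_coordEquiv_span_X, himg _ hs₁,
      himg _ hs₀, e₀, e₁]
  obtain ⟨g, rfl⟩ := (coordEquiv b).surjective f
  have hX : linForm w * coordEquiv b g = coordEquiv b (X ⟨w, hws⟩ * g) := by
    rw [map_mul, coordEquiv_X, hb]
  rw [hX, ← hmap] at hf
  rw [← hmap]
  have hmem : ∀ (I : Ideal (MvPolynomial s K)) (x : MvPolynomial s K),
      coordEquiv b x ∈ I.map (coordEquiv b) ↔ x ∈ I := by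
    intro I x
    refine ⟨fun h => ?_, fun h => Ideal.mem_map_of_mem _ h⟩
    obtain ⟨y, hy, hyx⟩ := (Ideal.mem_map_iff_of_surjective (coordEquiv b)
      (coordEquiv b).surjective).1 h
    exact (coordEquiv b).injective hyx ▸ hy
  rw [hmem] at hf ⊢
  refine mem_of_X_mul_mem ?_ hk ?_ hf
  · simp only [Finset.mem_filter, Finset.mem_univ, true_and]
    exact fun h => hw (e₀ ▸ Submodule.subset_span h)
  · simp only [Finset.mem_filter, Finset.mem_univ, true_and]
    exact fun h => hk' (e₁ ▸ Submodule.subset_span h)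

end Flats

/-! ### Ideals of products of linear forms, characterized by vanishing orders. -/

section Products

variable {K : Type*} [Field K] {σ : Type*} [Fintype σ] {ι : Type*} [Fintype ι]

/-- The number of forms, counted with multiplicities `m`, that belong to `L`. -/
noncomputable def weight (v : ι → σ → K) (m : ι → ℕ) (L : Submodule K (σ → K)) : ℕ :=
  open Classical in ∑ i with v i ∈ L, m i

/-- The ideal generated by the `a`-fold products of the linear forms `v i`, each of them
taken `m i` times. -/
noncomputable def foldIdeal (v : ι → σ → K) (m : ι → ℕ) (a : ℕ) : Ideal (MvPolynomial σ K) :=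
  Ideal.span {p | ∃ e : ι → ℕ, (∀ i, e i ≤ m i) ∧ ∑ i, e i = a ∧ p = ∏ i, linForm (v i) ^ e i}

/-- An `a`-fold product omits `∑ m - a` of the available factors; even if all omitted ones belong to
`L`, the stated number of factors in `L` remains. -/
theorem foldIdeal_le (v : ι → σ → K) (m : ι → ℕ) (a : ℕ) (L : Submodule K (σ → K)) {k : ℕ}
    (hk : k ≤ weight v m L + a - ∑ i, m i) : foldIdeal v m a ≤ flatIdeal L ^ k := by
  classical
  refine Ideal.span_le.2 ?_
  rintro _ ⟨e, he, hea, rfl⟩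
  have h1 : ∏ i with v i ∈ L, linForm (v i) ^ e i ∈ flatIdeal L ^ (∑ i with v i ∈ L, e i) := by
    rw [← Finset.prod_pow_eq_pow_sum]
    refine Ideal.prod_mem_prod fun i hi => Ideal.pow_mem_pow (linForm_mem_flatIdeal ?_) _
    simpa using hi
  refine Ideal.mem_of_dvd _ (Finset.prod_dvd_prod_of_subset _ _ _ (Finset.filter_subset _ _))
    (Ideal.pow_le_pow_right ?_ h1)
  have h2 : weight v m L = ∑ i with v i ∈ L, m i := by
    unfold weight
    congr
  have h3 : ∑ i with v i ∈ L, m i = ∑ i with v i ∈ L, e i + ∑ i with v i ∈ L, (m i - e i) := by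
    rw [← Finset.sum_add_distrib]
    exact Finset.sum_congr rfl fun i _ => (Nat.add_sub_of_le (he i)).symm
  have h4 : ∑ i, m i = ∑ i, e i + ∑ i, (m i - e i) := by
    rw [← Finset.sum_add_distrib]
    exact Finset.sum_congr rfl fun i _ => (Nat.add_sub_of_le (he i)).symm
  have h5 : ∑ i with v i ∈ L, (m i - e i) ≤ ∑ i, (m i - e i) :=
    Finset.sum_le_sum_of_subset (Finset.filter_subset _ _)
  omega

theorem linForm_mul_mem_foldIdeal [DecidableEq ι] (v : ι → σ → K) (m : ι → ℕ) (a : ℕ) (i : ι)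
    {f : MvPolynomial σ K} (hf : f ∈ foldIdeal v m a) :
    linForm (v i) * f ∈ foldIdeal v (m + Pi.single i 1) (a + 1) := by
  have h : foldIdeal v m a ≤ Submodule.comap
      (LinearMap.mulLeft (MvPolynomial σ K) (linForm (v i)))
      (foldIdeal v (m + Pi.single i 1) (a + 1)) := by
    refine Submodule.span_le.2 ?_
    rintro _ ⟨e, he, hea, rfl⟩
    refine Ideal.subset_span ⟨e + Pi.single i 1, fun j => ?_, ?_, ?_⟩
    · simpa using he j
    · simp [Finset.sum_add_distrib, hea]
    · simp only [LinearMap.mulLeft_apply, Pi.add_apply, pow_add, Finset.prod_mul_distrib]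
      rw [Finset.prod_eq_single (f := fun j => linForm (v j) ^ (Pi.single i 1 : ι → ℕ) j) i]
      · simp [mul_comm]
      · intro j _ hj
        simp [hj]
      · simp
  exact h hf

omit [Fintype σ] in
theorem weight_add_single [DecidableEq ι] (v : ι → σ → K) (m : ι → ℕ) (i : ι)
    (L : Submodule K (σ → K)) [Decidable (v i ∈ L)] :
    weight v (m + Pi.single i 1) L = weight v m L + if v i ∈ L then 1 else 0 := by
  classical
  unfold weight
  simp [Finset.sum_add_distrib]

/-- A polynomial lies in `M ^ s` times the ideal of `(∑ m - c)`-fold products, modulo the linear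
forms in `L₀`, as soon as it vanishes to the expected orders along all flats containing `L₀`. -/
theorem mem_mul_foldIdeal (v : ι → σ → K) (c s : ℕ) (L₀ : Submodule K (σ → K)) :
    ∀ (m : ι → ℕ) (f : MvPolynomial σ K),
      (∀ L, L₀ ≤ L → f ∈ flatIdeal L ^ (weight v m L - c) ⊔ flatIdeal L₀) →
      f ∈ flatIdeal ⊤ ^ (∑ i, m i - c + s) ⊔ flatIdeal L₀ →
      f ∈ flatIdeal ⊤ ^ s * foldIdeal v m (∑ i, m i - c) ⊔ flatIdeal L₀ := by
  classical
  -- The outer induction descends from larger flats to smaller ones; the inner one is on the total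
  -- multiplicity.
  induction L₀ using WellFoundedGT.induction with
  | ind L₀ ihL =>
  intro m
  induction hN : ∑ i, m i generalizing m with
  | zero =>
    intro f _ hf
    have h1 : foldIdeal v m 0 = ⊤ :=
      (Ideal.eq_top_iff_one _).2 (Ideal.subset_span ⟨0, by simp, by simp, by simp⟩)
    simpa [h1] using hf
  | succ N ihN =>
    intro f hL hT
    by_cases hc : N + 1 ≤ c
    · have h1 : foldIdeal v m (N + 1 - c) = ⊤ := by
        rw [Nat.sub_eq_zero_of_le hc]
        exact (Ideal.eq_top_iff_one _).2 (Ideal.subset_span ⟨0, by simp, by simp, by simp⟩)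
      rw [h1, Ideal.mul_top]
      rwa [Nat.sub_eq_zero_of_le hc, zero_add] at hT
    -- If every available form lies in `L₀`, the condition at `L₀` itself has positive exponent and
    -- forces `f ∈ flatIdeal L₀`.
    by_cases hall : ∀ i, m i ≠ 0 → v i ∈ L₀
    · have hw : weight v m L₀ = N + 1 := by
        rw [← hN]
        unfold weight
        rw [Finset.sum_filter]
        refine Finset.sum_congr rfl fun i _ => ?_
        by_cases hi : m i = 0
        · simp [hi]
        · simp [hall i hi]
      have h := hL L₀ le_rfl
      rw [hw, sup_eq_right.2 (Ideal.pow_le_self (by omega))] at h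
      exact Ideal.mem_sup_right h
    push Not at hall
    obtain ⟨i, hi, hiL⟩ := hall
    obtain ⟨m, rfl⟩ : ∃ m', m = m' + Pi.single i 1 := by
      refine ⟨m - Pi.single i 1, (tsub_add_cancel_of_le ?_).symm⟩
      intro j
      by_cases hj : j = i
      · subst hj
        simpa using Nat.one_le_iff_ne_zero.2 hi
      · simp [hj]
    have hN' : ∑ i, m i = N := by
      simpa [Finset.sum_add_distrib] using hN
    have hlt : L₀ < L₀ ⊔ Submodule.span K {v i} := by
      refine lt_of_le_of_ne le_sup_left fun h => hiL ?_
      rw [h]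
      exact Submodule.mem_sup_right (Submodule.mem_span_singleton_self _)
    have hmono : flatIdeal L₀ ≤ flatIdeal (L₀ ⊔ Submodule.span K {v i}) := flatIdeal_mono hlt.le
    have h1 := ihL _ hlt (m + Pi.single i 1) f
      (fun L hle => sup_le_sup_left hmono _ (hL L (hlt.le.trans hle)))
      (by rw [hN]; exact sup_le_sup_left hmono _ hT)
    rw [hN, flatIdeal_sup, flatIdeal_span_singleton] at h1
    obtain ⟨g, hg, x, hx, rfl⟩ := Submodule.mem_sup.1 h1
    obtain ⟨x₀, hx₀, y, hy, rfl⟩ := Submodule.mem_sup.1 hx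
    obtain ⟨h, rfl⟩ := Ideal.mem_span_singleton'.1 hy
    rw [mul_comm h] at hL hT ⊢
    have key : ∀ I : Ideal (MvPolynomial σ K), g ∈ I →
        g + (x₀ + linForm (v i) * h) ∈ I ⊔ flatIdeal L₀ →
        linForm (v i) * h ∈ I ⊔ flatIdeal L₀ := by
      intro I hgI hsum
      have h2 := Ideal.sub_mem _ hsum
        (Ideal.add_mem _ (Ideal.mem_sup_left hgI) (Ideal.mem_sup_right hx₀))
      convert h2 using 1
      ring
    have hgF : g ∈ foldIdeal v (m + Pi.single i 1) (N + 1 - c) := by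
      have hle : flatIdeal (⊤ : Submodule K (σ → K)) ^ s *
          foldIdeal v (m + Pi.single i 1) (N + 1 - c) ≤
            foldIdeal v (m + Pi.single i 1) (N + 1 - c) := Ideal.mul_le_right
      exact hle hg
    have hgT : g ∈ flatIdeal ⊤ ^ (N + 1 - c + s) := by
      rw [pow_add, mul_comm]
      refine Ideal.mul_mono_right (foldIdeal_le _ _ _ _ ?_) hg
      rw [hN]
      have : weight v (m + Pi.single i 1) ⊤ = N + 1 := by
        rw [← hN]
        simp [weight]
      omega
    -- By `foldIdeal_le` the summand `g` has all required orders, hence so does `linForm (v i) * h`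
    -- modulo `L₀`. Division lowers these orders no more than removing one copy of `v i` lowers the
    -- requirements.
    have hh := ihN m hN' h
      (fun L hle => mem_of_linForm_mul_mem hle hiL (by rw [weight_add_single]; omega)
        (fun hm => by rw [weight_add_single, if_pos hm]; omega)
        (key _ (foldIdeal_le _ _ _ _ (by rw [hN]; omega) hgF) (hL L hle)))
      (mem_of_linForm_mul_mem le_top hiL (by omega) (fun _ => by omega) (key _ hgT hT))
    have hmul : linForm (v i) * h ∈
        flatIdeal ⊤ ^ s * foldIdeal v (m + Pi.single i 1) (N + 1 - c) ⊔ flatIdeal L₀ := by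
      obtain ⟨p, hp, q, hq, rfl⟩ := Submodule.mem_sup.1 hh
      rw [mul_add]
      refine Ideal.add_mem _ (Ideal.mem_sup_left ?_)
        (Ideal.mem_sup_right (Ideal.mul_mem_left _ _ hq))
      refine Submodule.mul_induction_on hp ?_ ?_
      · intro a ha b hb
        rw [mul_left_comm]
        refine Ideal.mul_mem_mul ha ?_
        have := linForm_mul_mem_foldIdeal v m _ i hb
        rwa [show N - c + 1 = N + 1 - c by omega] at this
      · intro a b ha hb
        rw [mul_add]
        exact Ideal.add_mem _ ha hb
    exact Ideal.add_mem _ (Ideal.mem_sup_left hg)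
      (Ideal.add_mem _ (Ideal.mem_sup_right hx₀) hmul)

end Products

/-! ### Bezout-type addition of vanishing orders, and a degree criterion. -/

section Bezout

attribute [local instance] MvPolynomial.gradedAlgebra

variable {K : Type*} [Field K] {σ : Type*} [Fintype σ]

/-- Orders of vanishing along different flats of the hyperplane `L₀` add up. -/
theorem mem_pow_sum_sup {J : Type*} (L₀ : Submodule K (σ → K)) (s : Finset J)
    (w : J → σ → K) (hw : ∀ i ∈ s, ∀ j ∈ s, i ≠ j → w i ∉ L₀ ⊔ Submodule.span K {w j})
    (hw₀ : ∀ i ∈ s, w i ∉ L₀) (k : J → ℕ) {f : MvPolynomial σ K}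
    (hf : ∀ j ∈ s, f ∈ flatIdeal (L₀ ⊔ Submodule.span K {w j}) ^ k j ⊔ flatIdeal L₀) :
    f ∈ flatIdeal ⊤ ^ (∑ j ∈ s, k j) ⊔ flatIdeal L₀ := by
  classical
  induction hN : ∑ j ∈ s, k j generalizing k f with
  | zero => simp
  | succ N ih =>
    obtain ⟨j, hj, hkj⟩ : ∃ j ∈ s, k j ≠ 0 := by
      by_contra! h
      rw [Finset.sum_eq_zero h] at hN
      omega
    have h1 : f ∈ flatIdeal L₀ ⊔ Ideal.span {linForm (w j)} := by
      rw [← flatIdeal_span_singleton, ← flatIdeal_sup]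
      exact sup_le (Ideal.pow_le_self hkj) (flatIdeal_mono le_sup_left) (hf j hj)
    obtain ⟨x₀, hx₀, y, hy, rfl⟩ := Submodule.mem_sup.1 h1
    obtain ⟨h, rfl⟩ := Ideal.mem_span_singleton'.1 hy
    rw [mul_comm h] at hf ⊢
    have h2 : ∀ i ∈ s, linForm (w j) * h ∈
        flatIdeal (L₀ ⊔ Submodule.span K {w i}) ^ k i ⊔ flatIdeal L₀ := fun i hi => by
      have := Ideal.sub_mem _ (hf i hi) (Ideal.mem_sup_right hx₀)
      rwa [add_sub_cancel_left] at this
    -- Dividing by `linForm (w j)` costs one order along its own flat and none along the others,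
    -- which do not contain `w j`.
    have h3 := ih (f := h) (Function.update k j (k j - 1)) (fun i hi => by
        refine mem_of_linForm_mul_mem le_sup_left (hw₀ j hj) ?_ ?_ (h2 i hi)
        · by_cases hij : i = j
          · subst hij
            simp
          · simp [hij]
        · intro hmem
          by_cases hij : i = j
          · subst hij
            simp
          · exact absurd hmem (hw j hj i hi (Ne.symm hij)))
      (by
        rw [Finset.sum_update_of_mem hj]
        rw [← Finset.add_sum_erase s k hj, Finset.erase_eq] at hN
        omega)
    obtain ⟨p, hp, q, hq, rfl⟩ := Submodule.mem_sup.1 h3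
    refine Ideal.add_mem _ (Ideal.mem_sup_right hx₀) ?_
    rw [mul_add]
    refine Ideal.add_mem _ (Ideal.mem_sup_left ?_)
      (Ideal.mem_sup_right (Ideal.mul_mem_left _ _ hq))
    rw [pow_succ']
    exact Ideal.mul_mem_mul (linForm_mem_flatIdeal trivial) hp

theorem linForm_isHomogeneous (v : σ → K) : (linForm v).IsHomogeneous 1 := by
  rw [linForm, Fintype.linearCombination_apply]
  refine IsHomogeneous.sum _ _ _ fun i _ => ?_
  rw [smul_eq_C_mul]
  exact isHomogeneous_C_mul_X _ _

theorem flatIdeal_isHomogeneous (L : Submodule K (σ → K)) :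
    (flatIdeal L).IsHomogeneous (homogeneousSubmodule σ K) := by
  refine Ideal.homogeneous_span _ _ ?_
  rintro _ ⟨v, -, rfl⟩
  exact ⟨1, linForm_isHomogeneous v⟩

theorem flatIdeal_pow_isHomogeneous (L : Submodule K (σ → K)) (k : ℕ) :
    (flatIdeal L ^ k).IsHomogeneous (homogeneousSubmodule σ K) := by
  induction k with
  | zero =>
    rw [pow_zero, Ideal.one_eq_top]
    exact Ideal.IsHomogeneous.top _
  | succ k ih =>
    rw [pow_succ]
    exact ih.mul (flatIdeal_isHomogeneous L)

/-- Since `flatIdeal L` is homogeneous, components can be tested separately: below degree `d` the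
first summand contributes nothing, and from `d` on `f` has no component. -/
theorem mem_flatIdeal_of_totalDegree_lt (L : Submodule K (σ → K)) {d : ℕ} {f : MvPolynomial σ K}
    (hd : f.totalDegree < d) (hf : f ∈ flatIdeal ⊤ ^ d ⊔ flatIdeal L) : f ∈ flatIdeal L := by
  obtain ⟨x, hx, y, hy, hxy⟩ := Submodule.mem_sup.1 hf
  rw [mem_iff_homogeneousComponent_mem (flatIdeal_isHomogeneous L)]
  intro e
  by_cases he : e < d
  · have hx0 : homogeneousComponent e x = 0 := by
      rw [flatIdeal_top, mem_pow_idealOfVars_iff'] at hx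
      ext m
      rw [coeff_homogeneousComponent]
      split_ifs with hm
      · exact hx m (by omega)
      · rfl
    rw [← hxy, map_add, hx0, zero_add]
    exact homogeneousComponent_mem_of_mem (flatIdeal_isHomogeneous L) hy e
  · rw [homogeneousComponent_eq_zero _ _ (by omega)]
    exact Ideal.zero_mem _

end Bezout

/-! ### Lower bound for the degree of polynomials vanishing on the fat points. -/

section Arrangement

variable {K : Type*} [Field K] {σ : Type*} [Fintype σ] {ι : Type*} [Fintype ι]

theorem exists_linForm_eq {f : MvPolynomial σ K} (hf : f.IsHomogeneous 1) :
    ∃ v, linForm v = f := by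
  rw [← mem_homogeneousSubmodule, homogeneousSubmodule_one_eq_span_X,
    Submodule.mem_span_range_iff_exists_fun] at hf
  obtain ⟨v, hv⟩ := hf
  exact ⟨v, by rw [linForm, Fintype.linearCombination_apply, hv]⟩

omit [Fintype σ] in
theorem weight_one (v : ι → σ → K) (L : Submodule K (σ → K)) [DecidablePred fun i => v i ∈ L] :
    weight v 1 L = (Finset.univ.filter fun i => v i ∈ L).card := by
  simp only [weight, Pi.one_apply, Finset.sum_const, smul_eq_mul, mul_one]
  congr

omit [Fintype σ] in
theorem weight_const (v : ι → σ → K) (r : ℕ) (L : Submodule K (σ → K)) :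
    weight v (fun _ => r) L = r * weight v 1 L := by
  classical
  rw [weight_one, weight, Finset.sum_const, smul_eq_mul, mul_comm]

omit [Fintype ι] in
theorem mem_of_prod_linForm_mul_mem {L₀ L : Submodule K (σ → K)} (hle : L₀ ≤ L)
    [DecidablePred (· ∈ L)] (v : ι → σ → K) (s : Finset ι) (hs : ∀ i ∈ s, v i ∉ L₀) {k k' : ℕ}
    (hk : k' ≤ k - (s.filter fun i => v i ∈ L).card) {f : MvPolynomial σ K}
    (hf : (∏ i ∈ s, linForm (v i)) * f ∈ flatIdeal L ^ k ⊔ flatIdeal L₀) :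
    f ∈ flatIdeal L ^ k' ⊔ flatIdeal L₀ := by
  classical
  induction s using Finset.induction_on generalizing k with
  | empty =>
    rw [Finset.prod_empty, one_mul] at hf
    have hk' : k' ≤ k := by simpa using hk
    exact sup_le_sup_right (Ideal.pow_le_pow_right (I := flatIdeal L) hk') (flatIdeal L₀) hf
  | insert a s ha ih =>
    rw [Finset.prod_insert ha, mul_assoc] at hf
    refine ih (fun i hi => hs i (Finset.mem_insert_of_mem hi))
      (k := k - if v a ∈ L then 1 else 0) ?_
      (mem_of_linForm_mul_mem hle (hs a (Finset.mem_insert_self _ _)) (Nat.sub_le _ _) ?_ hf)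
    · rw [Finset.filter_insert] at hk
      split_ifs at hk ⊢
      · rw [Finset.card_insert_of_notMem (by simp [ha])] at hk
        omega
      · simpa using hk
    · intro h
      simp [h]

-- The factors already extracted lie outside the span of the next `v a`, so they cancel modulo it
-- without loss of order, and `linForm (v a)` divides the cofactor.
omit [Fintype ι] in
theorem exists_eq_prod_mul (v : ι → σ → K)
    (hv : ∀ i j, i ≠ j → v i ∉ Submodule.span K {v j}) (s : Finset ι) {f : MvPolynomial σ K}
    (hf : ∀ i ∈ s, f ∈ flatIdeal (Submodule.span K {v i})) :
    ∃ g, f = (∏ i ∈ s, linForm (v i)) * g := by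
  classical
  induction s using Finset.induction_on with
  | empty => exact ⟨f, by simp⟩
  | insert a s ha ih =>
    obtain ⟨g, rfl⟩ := ih fun i hi => hf i (Finset.mem_insert_of_mem hi)
    have hva : ∀ i ∈ s, v i ∉ Submodule.span K {v a} := fun i hi =>
      hv i a fun h => ha (h ▸ hi)
    have h1 := mem_of_prod_linForm_mul_mem le_rfl v s hva (k := 1) (k' := 1)
      (by rw [Finset.filter_false_of_mem hva]; simp) (f := g)
      (by simpa using hf a (Finset.mem_insert_self _ _))
    rw [pow_one, sup_idem, flatIdeal_span_singleton, Ideal.mem_span_singleton] at h1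
    obtain ⟨g', rfl⟩ := h1
    exact ⟨g', by rw [Finset.prod_insert ha]; ring⟩

omit [Fintype σ] in
theorem finrank_span_sup_span {v w : σ → K} (hv : v ≠ 0) (hw : w ∉ Submodule.span K {v}) :
    Module.finrank K ↥(Submodule.span K {v} ⊔ Submodule.span K {w}) = 2 := by
  have hli : LinearIndependent K ![v, w] := by
    refine (LinearIndependent.pair_iff' hv).2 fun a h => hw ?_
    exact Submodule.mem_span_singleton.2 ⟨a, h⟩
  have h := finrank_span_eq_card hli
  rw [Matrix.range_cons, Matrix.range_cons, Matrix.range_empty, Set.union_empty,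
    Submodule.span_union] at h
  simpa using h

/-- A form of small degree vanishing along the rank two flats of an arrangement to the orders
`e * (weight - 1)` is divisible by each form of the arrangement. -/
theorem mem_flatIdeal_span_of_vanishing (v : ι → σ → K) (h0 : ∀ i, v i ≠ 0)
    (hv : ∀ i j, i ≠ j → v i ∉ Submodule.span K {v j}) (e : ℕ) {f : MvPolynomial σ K}
    (hd : f.totalDegree < e * (Fintype.card ι - 1))
    (hf : ∀ L : Submodule K (σ → K), Module.finrank K L = 2 →
      f ∈ flatIdeal L ^ (e * (weight v 1 L - 1))) (i : ι) :
    f ∈ flatIdeal (Submodule.span K {v i}) := by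
  classical
  set L₀ := Submodule.span K {v i} with hL₀
  let φ : ι → Submodule K (σ → K) := fun j => L₀ ⊔ Submodule.span K {v j}
  let F : Finset (Submodule K (σ → K)) := (Finset.univ.erase i).image φ
  have hF : ∀ L ∈ F, ∃ j, j ≠ i ∧ φ j = L := by
    intro L hL
    obtain ⟨j, hj, hjL⟩ := Finset.mem_image.1 hL
    exact ⟨j, Finset.ne_of_mem_erase hj, hjL⟩
  have hrank : ∀ L ∈ F, Module.finrank K L = 2 := by
    intro L hL
    obtain ⟨j, hj, rfl⟩ := hF L hL
    exact finrank_span_sup_span (h0 i) (hv j i hj)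
  have : Nonempty ι := ⟨i⟩
  choose! g hg hgφ using hF
  -- Every other line meets line `i` in one flat of `F`; a flat `L` accounts for at most `weight v 1
  -- L - 1` of them, since `i` itself is excluded.
  have hsum : Fintype.card ι - 1 ≤ ∑ L ∈ F, (weight v 1 L - 1) := by
    rw [← Finset.card_univ, ← Finset.card_erase_of_mem (Finset.mem_univ i),
      Finset.card_eq_sum_card_image φ]
    refine Finset.sum_le_sum fun L hL => ?_
    have hiL : v i ∈ L := by
      rw [← hgφ L hL]
      exact Submodule.mem_sup_left (Submodule.mem_span_singleton_self _)
    rw [weight_one, ← Finset.card_erase_of_mem (a := i) (by simpa using hiL)]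
    refine Finset.card_le_card fun j hj => ?_
    obtain ⟨hji, rfl⟩ := Finset.mem_filter.1 hj
    refine Finset.mem_erase.2 ⟨Finset.ne_of_mem_erase hji, ?_⟩
    simpa using Submodule.mem_sup_right (Submodule.mem_span_singleton_self _)
  have hmem := mem_pow_sum_sup L₀ F (fun L => v (g L)) (fun L hL L' hL' hne hmem => ?_)
    (fun L hL => hv _ _ (hg L hL)) (fun L => e * (weight v 1 L - 1)) (f := f) (fun L hL => ?_)
  · rw [← Finset.mul_sum] at hmem
    exact mem_flatIdeal_of_totalDegree_lt _ (hd.trans_le (Nat.mul_le_mul_left _ hsum)) hmem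
  · have e' : L₀ ⊔ Submodule.span K {v (g L')} = L' := hgφ L' hL'
    rw [e'] at hmem
    refine hne (Submodule.eq_of_le_of_finrank_eq ?_ ((hrank L hL).trans (hrank L' hL').symm))
    rw [← hgφ L hL]
    refine sup_le ?_ ((Submodule.span_singleton_le_iff_mem _ _).2 hmem)
    rw [← e']
    exact le_sup_left
  · have e' : L₀ ⊔ Submodule.span K {v (g L)} = L := hgφ L hL
    simp only [e']
    exact Ideal.mem_sup_left (hf L (hrank L hL))

/-- There is no nonzero polynomial of degree less than `c * n - δ` that vanishes to the orders
`(2 * c - δ) * (weight - 1)` along the rank two flats of an arrangement. -/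
theorem eq_zero_of_vanishing (v : ι → σ → K) (h0 : ∀ i, v i ≠ 0)
    (hv : ∀ i j, i ≠ j → v i ∉ Submodule.span K {v j}) (hn : 2 ≤ Fintype.card ι) {δ : ℕ}
    (hδ : δ ≤ 1) (c : ℕ) {f : MvPolynomial σ K}
    (hd : f.totalDegree + δ < c * Fintype.card ι)
    (hf : ∀ L : Submodule K (σ → K), Module.finrank K L = 2 →
      f ∈ flatIdeal L ^ ((2 * c - δ) * (weight v 1 L - 1))) : f = 0 := by
  classical
  induction c generalizing f with
  | zero => simp at hd
  | succ c ih =>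
    -- With `n` lines, this rests on `n ≤ 2 * (n - 1)`.
    have hdeg : f.totalDegree < (2 * (c + 1) - δ) * (Fintype.card ι - 1) := by
      obtain ⟨N, hN⟩ := Nat.exists_eq_add_of_le hn
      rw [hN] at hd ⊢
      rw [show 2 + N - 1 = N + 1 by omega]
      interval_cases δ
      · rw [Nat.sub_zero]
        nlinarith [Nat.zero_le (c * N)]
      · rw [show 2 * (c + 1) - 1 = 2 * c + 1 by omega]
        nlinarith [Nat.zero_le (c * N)]
    obtain ⟨g, rfl⟩ := exists_eq_prod_mul v hv Finset.univ fun i _ =>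
      mem_flatIdeal_span_of_vanishing v h0 hv _ hdeg hf i
    by_contra hne
    have hP : ∏ i, linForm (v i) ≠ 0 := left_ne_zero_of_mul hne
    have hg : g ≠ 0 := right_ne_zero_of_mul hne
    refine hg (ih ?_ fun L hL => ?_)
    · have hPd : (∏ i, linForm (v i)).totalDegree = Fintype.card ι := by
        have := (IsHomogeneous.prod Finset.univ (fun i => linForm (v i)) (fun _ => 1)
          fun i _ => linForm_isHomogeneous (v i)).totalDegree hP
        simpa using this
      rw [totalDegree_mul_of_isDomain hP hg, hPd, Nat.succ_mul] at hd
      omega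
    · have h1 : (∏ i, linForm (v i)) * g ∈
          flatIdeal L ^ ((2 * (c + 1) - δ) * (weight v 1 L - 1)) ⊔ flatIdeal ⊥ :=
        Ideal.mem_sup_left (hf L hL)
      have h2 := mem_of_prod_linForm_mul_mem bot_le v Finset.univ (fun i _ => by simpa using h0 i)
        (k' := (2 * c - δ) * (weight v 1 L - 1)) ?_ h1
      · simpa [flatIdeal_bot] using h2
      · rw [← weight_one]
        obtain hw | ⟨x, hx⟩ : weight v 1 L ≤ 1 ∨ ∃ x, weight v 1 L = x + 2 := by
          rcases Nat.lt_or_ge 1 (weight v 1 L) with h | h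
          · exact Or.inr ⟨_, (Nat.sub_add_cancel h).symm⟩
          · exact Or.inl h
        · rw [Nat.sub_eq_zero_of_le hw]
          simp
        · rw [hx, show x + 2 - 1 = x + 1 by omega]
          -- For `c = 0` truncated subtraction makes the required order zero. Otherwise the order
          -- drops by `2 * (x + 1)`, which covers the `x + 2` factors removed.
          rcases Nat.eq_zero_or_pos c with rfl | hc
          · simp
          · rw [show 2 * (c + 1) - δ = (2 * c - δ) + 2 by omega, Nat.add_mul]
            omega

end Arrangement

/-! ### Points of the plane as rank two flats, and the containments. -/

section Plane

attribute [local instance] MvPolynomial.gradedAlgebra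

variable {K : Type*} [Field K]

/-- The space of coefficient vectors of the linear forms vanishing at `P`. -/
noncomputable def pointSpace (P : Plane K) : Submodule K (Fin 3 → K) :=
  LinearMap.ker (Fintype.linearCombination K P.rep)

theorem mem_pointSpace_iff {P : Plane K} {v : Fin 3 → K} :
    v ∈ pointSpace P ↔ eval P.rep (linForm v) = 0 := by
  simp [pointSpace, linForm, Fintype.linearCombination_apply, smul_eval]

theorem aeval_mul_of_isHomogeneous {σ A : Type*} [CommRing A] [Algebra K A]
    {f : MvPolynomial σ K} {d : ℕ} (hf : f.IsHomogeneous d) (a : σ → A) (y : A) :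
    aeval (fun i => a i * y) f = aeval a f * y ^ d := by
  rw [aeval_def, aeval_def, eval₂_eq, eval₂_eq, Finset.sum_mul]
  refine Finset.sum_congr rfl fun m hm => ?_
  simp only [mul_pow, Finset.prod_mul_distrib, Finset.prod_pow_eq_pow_sum]
  rw [← hf.degree_eq_sum_deg_support hm, mul_assoc]

/-- Choose a coordinate `p j ≠ 0`. Modulo the linear forms vanishing at `P`, each `X i` equals `(p i
/ p j) * X j`, so a form of degree `d` becomes its value at `p / p j` times `X j ^ d`. -/
theorem pointIdeal_eq_flatIdeal (P : Plane K) : pointIdeal P = flatIdeal (pointSpace P) := by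
  apply le_antisymm
  · refine Ideal.span_le.2 ?_
    rintro f ⟨⟨d, hd⟩, hf⟩
    obtain ⟨j, hj⟩ := Function.ne_iff.1 P.rep_nonzero
    set I := flatIdeal (pointSpace P)
    set p := P.rep
    have hj' : p j ≠ 0 := hj
    have hX : ∀ i, Ideal.Quotient.mkₐ K I (X i) =
        algebraMap K _ (p i * (p j)⁻¹) * Ideal.Quotient.mkₐ K I (X j) := by
      classical
      intro i
      rw [← (Ideal.Quotient.mkₐ K I).commutes, ← map_mul, Ideal.Quotient.mkₐ_eq_mk,
        Ideal.Quotient.eq]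
      have h1 : (Pi.single i 1 - Pi.single j (p i * (p j)⁻¹) : Fin 3 → K) ∈ pointSpace P := by
        simp only [pointSpace, LinearMap.mem_ker, map_sub,
          Fintype.linearCombination_apply_single, smul_eq_mul]
        field_simp
        simp [p]
      have h2 := linForm_mem_flatIdeal h1
      simpa [linForm, Fintype.linearCombination_apply_single, smul_eq_C_mul] using h2
    have h0 : aeval (fun i => p i * (p j)⁻¹) f = 0 := by
      have h1 : aeval p f = 0 := (RingHom.congr_fun (coe_aeval_eq_eval p) f).trans hf
      rw [aeval_mul_of_isHomogeneous hd, h1, zero_mul]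
    have h3 : Ideal.Quotient.mkₐ K I f = 0 := by
      have h4 : Ideal.Quotient.mkₐ K I = aeval fun i => algebraMap K _ (p i * (p j)⁻¹) *
          Ideal.Quotient.mkₐ K I (X j) := by
        ext i
        rw [hX, aeval_X]
      rw [h4, aeval_mul_of_isHomogeneous hd,
        show aeval (fun i => algebraMap K (MvPolynomial (Fin 3) K ⧸ I) (p i * (p j)⁻¹)) f =
          algebraMap K _ (aeval (fun i => p i * (p j)⁻¹) f) from
            aeval_algebraMap_apply _ _ _, h0, map_zero, zero_mul]
    exact Ideal.Quotient.eq_zero_iff_mem.1 h3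
  · refine Ideal.span_le.2 ?_
    rintro _ ⟨v, hv, rfl⟩
    exact Ideal.subset_span ⟨⟨1, linForm_isHomogeneous v⟩, mem_pointSpace_iff.1 hv⟩

/-- `L` is the kernel of a functional, whose values on the standard basis are the coordinates of the
point; passing to `rep` only rescales them. -/
theorem exists_pointSpace_eq {L : Submodule K (Fin 3 → K)} (hL : Module.finrank K L = 2) :
    ∃ P : Plane K, pointSpace P = L := by
  classical
  have hlt : L < ⊤ := by
    refine lt_top_iff_ne_top.2 fun h => ?_
    rw [h, finrank_top] at hL
    simp at hL
  obtain ⟨φ, hφ, hle⟩ := Submodule.exists_le_ker_of_lt_top L hlt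
  let w : Fin 3 → K := fun i => φ (Pi.single i 1)
  have hφw : ∀ u, φ u = Fintype.linearCombination K w u := by
    intro u
    have : φ = Fintype.linearCombination K w := by
      refine (Pi.basisFun K (Fin 3)).ext fun i => ?_
      simp [w, Fintype.linearCombination_apply_single]
    rw [← this]
  have hw : w ≠ 0 := by
    intro h
    refine hφ (LinearMap.ext fun u => ?_)
    rw [hφw, h]
    simp [Fintype.linearCombination_apply]
  obtain ⟨a, ha⟩ := Projectivization.exists_smul_eq_mk_rep K w hw
  refine ⟨Projectivization.mk K w hw, (Submodule.eq_of_le_of_finrank_le ?_ ?_).symm⟩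
  · intro u hu
    have h1 : φ u = 0 := hle hu
    rw [hφw, Fintype.linearCombination_apply] at h1
    rw [pointSpace, LinearMap.mem_ker, ← ha, Fintype.linearCombination_apply]
    have h2 : ∀ i, u i • (a • w) i = (a : K) * (u i • w i) := fun i => by
      simp only [Pi.smul_apply, Units.smul_def, smul_eq_mul]
      ring
    simp only [h2]
    rw [← Finset.mul_sum, h1, mul_zero]
  · have hne : pointSpace (Projectivization.mk K w hw) ≠ ⊤ := by
      intro h
      obtain ⟨j, hj⟩ := Function.ne_iff.1 (Projectivization.mk K w hw).rep_nonzero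
      refine hj ?_
      have h1 : Pi.single j (1 : K) ∈ pointSpace (Projectivization.mk K w hw) := h ▸ trivial
      simpa [pointSpace, Fintype.linearCombination_apply_single] using h1
    have h3 := Submodule.finrank_lt hne
    have h4 : Module.finrank K (Fin 3 → K) = 3 := by simp
    omega

theorem irrelevantIdeal_eq_flatIdeal : irrelevantIdeal K = flatIdeal ⊤ :=
  flatIdeal_top.symm

variable {n : ℕ}

theorem numLines_eq_weight (v : Fin n → Fin 3 → K) (P : Plane K) :
    numLines (fun i => linForm (v i)) P = weight v 1 (pointSpace P) := by
  classical
  rw [weight_one, numLines, ← Set.ncard_coe_finset]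
  congr 1
  ext i
  simp [mem_pointSpace_iff]

theorem mem_fatPointsIdeal_iff {S : Set (Plane K)} {m : Plane K → ℕ} {f : CoordRing K} :
    f ∈ fatPointsIdeal S m ↔ ∀ P ∈ S, f ∈ flatIdeal (pointSpace P) ^ m P := by
  simp [fatPointsIdeal, pointIdeal_eq_flatIdeal]

theorem mem_flatIdeal_pow_of_mem_symbolicPower {v : Fin n → Fin 3 → K} {t : ℕ} {f : CoordRing K}
    (hf : f ∈ symbolicPower (fun i => linForm (v i)) t) {L : Submodule K (Fin 3 → K)}
    (hL : Module.finrank K L = 2) : f ∈ flatIdeal L ^ (t * (weight v 1 L - 1)) := by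
  obtain ⟨P, rfl⟩ := exists_pointSpace_eq hL
  by_cases hP : 2 ≤ weight v 1 (pointSpace P)
  · have h := mem_fatPointsIdeal_iff.1 hf P
      (show 2 ≤ numLines _ P by rwa [numLines_eq_weight])
    rwa [lineMult, numLines_eq_weight] at h
  · rw [Nat.sub_eq_zero_of_le (by omega), mul_zero, pow_zero, Ideal.one_eq_top]
    trivial

/-- Take the `i`-th generator to the power `r - e i`. These exponents sum to `r`, and `linForm (v
j)` then occurs `r - (r - e j) = e j` times. -/
theorem foldIdeal_const_le (v : Fin n → Fin 3 → K) {r : ℕ} (hn : 1 ≤ n) :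
    foldIdeal v (fun _ => r) (n * r - r) ≤ productIdeal (fun i => linForm (v i)) ^ r := by
  refine Ideal.span_le.2 ?_
  rintro _ ⟨e, he, hea, rfl⟩
  have hr : r ≤ n * r := Nat.le_mul_of_pos_left r hn
  have h1 : ∑ i, (r - e i) = r := by
    have h2 : ∑ i, (e i + (r - e i)) = n * r := by
      rw [Finset.sum_congr rfl fun i _ => Nat.add_sub_of_le (he i)]
      simp
    rw [Finset.sum_add_distrib] at h2
    omega
  have h3 : ∏ i, linForm (v i) ^ e i =
      ∏ i, (∏ j ∈ Finset.univ.erase i, linForm (v j)) ^ (r - e i) := by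
    simp only [← Finset.prod_pow]
    rw [Finset.prod_comm' (t' := Finset.univ) (s' := fun j => Finset.univ.erase j)
      (by simp [eq_comm])]
    refine Finset.prod_congr rfl fun j _ => ?_
    rw [Finset.prod_pow_eq_pow_sum]
    congr 1
    have h4 := Finset.add_sum_erase Finset.univ (fun i => r - e i) (Finset.mem_univ j)
    have h5 : e j ≤ r := he j
    omega
  have h6 : ∏ i, (∏ j ∈ Finset.univ.erase i, linForm (v j)) ^ (r - e i) ∈
      productIdeal (fun i => linForm (v i)) ^ ∑ i, (r - e i) := by
    rw [← Finset.prod_pow_eq_pow_sum]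
    refine Ideal.prod_mem_prod fun i _ => Ideal.pow_mem_pow ?_ _
    exact Ideal.subset_span (Set.mem_range_self i)
  rw [h3]
  rwa [h1] at h6

theorem symbolicPower_le (v : Fin n → Fin 3 → K) (h0 : ∀ i, v i ≠ 0)
    (hv : ∀ i j, i ≠ j → v i ∉ Submodule.span K {v j}) (hn : 2 ≤ n) {r δ : ℕ} (hδ : δ ≤ 1)
    (hr : 1 ≤ r) :
    symbolicPower (fun i => linForm (v i)) (2 * r - δ) ≤
      irrelevantIdeal K ^ (r - δ) * productIdeal (fun i => linForm (v i)) ^ r := by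
  classical
  intro f hf
  have hL := fun {L : Submodule K (Fin 3 → K)} => mem_flatIdeal_pow_of_mem_symbolicPower hf (L := L)
  have hnr : r ≤ n * r := Nat.le_mul_of_pos_left r (by omega)
  -- The ideals involved are homogeneous, so every component of `f` inherits its vanishing orders,
  -- and those of degree below `n * r - δ` are zero.
  have hdeg : f ∈ flatIdeal ⊤ ^ (n * r - δ) := by
    rw [flatIdeal_top, mem_pow_idealOfVars_iff']
    intro m hm
    have hcomp : homogeneousComponent m.degree f = 0 := by
      refine eq_zero_of_vanishing v h0 hv (by simpa using hn) hδ r ?_ fun L hL2 => ?_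
      · have := (homogeneousComponent_isHomogeneous m.degree f).totalDegree_le
        rw [Fintype.card_fin, mul_comm]
        omega
      · exact homogeneousComponent_mem_of_mem (flatIdeal_pow_isHomogeneous L _) (hL hL2) _
    have := congrArg (coeff m) hcomp
    rwa [coeff_homogeneousComponent, if_pos rfl, coeff_zero] at this
  -- Only flats containing two of the forms impose a condition. In rank two the symbolic power
  -- suffices because `r ≤ 2 * r - δ`; in rank three `L = ⊤` and `hdeg` applies.
  have hweight : ∀ L : Submodule K (Fin 3 → K),
      f ∈ flatIdeal L ^ (weight v (fun _ => r) L - r) := by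
    intro L
    rw [weight_const]
    by_cases hw : weight v 1 L ≤ 1
    · rw [Nat.sub_eq_zero_of_le (by nlinarith), pow_zero, Ideal.one_eq_top]
      trivial
    have hcard := hw
    rw [weight_one, not_le, Finset.one_lt_card] at hcard
    obtain ⟨i, hi, j, hj, hij⟩ := hcard
    have hle : Submodule.span K {v j} ⊔ Submodule.span K {v i} ≤ L := by
      simp only [Finset.mem_filter, Finset.mem_univ, true_and] at hi hj
      simp [hi, hj]
    have h2 := Submodule.finrank_mono hle
    rw [finrank_span_sup_span (h0 j) (hv i j hij)] at h2
    have h3 := Submodule.finrank_le L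
    rw [Module.finrank_fin_fun] at h3
    obtain h | h : Module.finrank K L = 2 ∨ Module.finrank K L = 3 := by omega
    · refine Ideal.pow_le_pow_right ?_ (hL h)
      obtain ⟨x, hx⟩ : ∃ x, weight v 1 L = x + 1 := ⟨weight v 1 L - 1, by omega⟩
      rw [hx, mul_add, mul_one, Nat.add_sub_cancel, Nat.add_sub_cancel]
      exact Nat.mul_le_mul_right _ (by omega)
    · obtain rfl : L = ⊤ := Submodule.eq_top_of_finrank_eq (by simpa using h)
      refine Ideal.pow_le_pow_right ?_ hdeg
      have : weight v 1 ⊤ = n := by simp [weight]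
      rw [this, mul_comm]
      omega
  have h := mem_mul_foldIdeal v r (r - δ) ⊥ (fun _ => r) f
    (fun L _ => Ideal.mem_sup_left (hweight L))
    (Ideal.mem_sup_left (Ideal.pow_le_pow_right (by simp; omega) hdeg))
  rw [flatIdeal_bot, sup_bot_eq] at h
  rw [irrelevantIdeal_eq_flatIdeal]
  refine Ideal.mul_mono_right ?_ h
  simpa using foldIdeal_const_le v (r := r) (by omega : 1 ≤ n)

theorem productIdeal_le_fatPointsIdeal (v : Fin n → Fin 3 → K) :
    productIdeal (fun i => linForm (v i)) ≤
      fatPointsIdeal (singularLocus fun i => linForm (v i))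
        (lineMult fun i => linForm (v i)) := by
  classical
  refine Ideal.span_le.2 ?_
  rintro _ ⟨i, rfl⟩
  refine mem_fatPointsIdeal_iff.2 fun P _ => ?_
  have h1 : ∏ j ∈ Finset.univ.erase i, linForm (v j) ∈ foldIdeal v 1 (n - 1) := by
    refine Ideal.subset_span ⟨fun j => if j = i then 0 else 1, fun j => ?_, ?_, ?_⟩
    · dsimp only
      split_ifs <;> simp
    · have h2 := Finset.add_sum_erase Finset.univ (fun j => if j = i then 0 else 1)
        (Finset.mem_univ i)
      rw [← h2, Finset.sum_congr rfl fun j hj => if_neg (Finset.ne_of_mem_erase hj)]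
      simp
    · rw [← Finset.mul_prod_erase Finset.univ _ (Finset.mem_univ i)]
      simp only [if_true, pow_zero, one_mul]
      exact Finset.prod_congr rfl fun j hj => by simp [Finset.ne_of_mem_erase hj]
  refine foldIdeal_le v 1 (n - 1) (pointSpace P) ?_ h1
  have := i.pos
  rw [lineMult, numLines_eq_weight]
  simp
  omega

/-- The ideal is proper, being inside the irrelevant ideal, so Krull's height theorem bounds its
height by the number of generators. -/
theorem two_le_of_height_eq_three (ℓ : Fin n → CoordRing K) (hlin : ∀ i, (ℓ i).IsHomogeneous 1)
    (hrank : (Ideal.span (Set.range ℓ)).height = 3) : 2 ≤ n := by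
  have hne : Ideal.span (Set.range ℓ) ≠ ⊤ := by
    intro h
    have hle : Ideal.span (Set.range ℓ) ≤ flatIdeal ⊤ := by
      refine Ideal.span_le.2 ?_
      rintro _ ⟨i, rfl⟩
      obtain ⟨v, hv⟩ := exists_linForm_eq (hlin i)
      exact hv ▸ linForm_mem_flatIdeal trivial
    have h1 : (1 : CoordRing K) ∈ flatIdeal (⊤ : Submodule K (Fin 3 → K)) ^ 1 := by
      rw [pow_one]
      exact hle (h ▸ trivial)
    rw [flatIdeal_top, mem_pow_idealOfVars_iff'] at h1
    simpa using h1 0 (by simp)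
  have h2 : (Ideal.span (Set.range ℓ)).height ≤ n := by
    refine (Ideal.height_le_spanFinrank _ hne).trans ?_
    refine (Submodule.spanFinrank_span_le_encard _).trans ?_
    rw [← Set.image_univ]
    refine (Set.encard_image_le _ _).trans ?_
    simp
  rw [hrank] at h2
  have h3 : 3 ≤ n := by exact_mod_cast h2
  omega

end Plane

end LineArrangement

theorem corollary3p4 {K : Type*} [Field K] [CharZero K] {n : ℕ}
    (ℓ : Fin n → LineArrangement.CoordRing K)
    -- the `ℓ i` are nonzero linear forms defining pairwise distinct lines
    (hlin : ∀ i, (ℓ i).IsHomogeneous 1)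
    (hne : ∀ i, ℓ i ≠ 0)
    (hdistinct : ∀ i j, i ≠ j → ∀ c : K, ℓ i ≠ c • ℓ j)
    -- the arrangement has rank three
    (hrank : (Ideal.span (Set.range ℓ)).height = 3) :
    LineArrangement.productIdeal ℓ =
        LineArrangement.fatPointsIdeal (LineArrangement.singularLocus ℓ)
          (LineArrangement.lineMult ℓ) ∧
      ∀ r : ℕ, 1 ≤ r →
        LineArrangement.symbolicPower ℓ (2 * r - 1) ≤
            LineArrangement.irrelevantIdeal K ^ (r - 1) * LineArrangement.productIdeal ℓ ^ r ∧
          LineArrangement.symbolicPower ℓ (2 * r) ≤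
            LineArrangement.irrelevantIdeal K ^ r * LineArrangement.productIdeal ℓ ^ r := by
  have hn := LineArrangement.two_le_of_height_eq_three ℓ hlin hrank
  choose v hv using fun i => LineArrangement.exists_linForm_eq (hlin i)
  obtain rfl : (fun i => LineArrangement.linForm (v i)) = ℓ := funext hv
  have h0 : ∀ i, v i ≠ 0 := fun i h => hne i (by simp [h])
  have hd : ∀ i j, i ≠ j → v i ∉ Submodule.span K {v j} := by
    intro i j hij hmem
    obtain ⟨c, hc⟩ := Submodule.mem_span_singleton.1 hmem
    exact hdistinct i j hij c (by simp only [← hc, map_smul])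
  have hle := fun (r δ : ℕ) (hδ : δ ≤ 1) (hr : 1 ≤ r) =>
    LineArrangement.symbolicPower_le v h0 hd hn hδ hr
  refine ⟨le_antisymm (LineArrangement.productIdeal_le_fatPointsIdeal v) ?_, fun r hr =>
    ⟨hle r 1 le_rfl hr, hle r 0 zero_le_one hr⟩⟩
  have h1 := hle 1 1 le_rfl le_rfl
  simpa [LineArrangement.symbolicPower, LineArrangement.fatPointsSymbolicPower] using h1
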